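/- Setting. Let $E$ be a topological space with a distinguished point $0$, let $M$ be a metric space (with a $\sigma$-algebra containing the open sets), $m_0$ a finite non-zero measure on $M$, $T:M\to M$ measurable, and $A_\varepsilon\subset M$ $(\varepsilon\in E)$ measurable sets. Let $(V,\|\cdot\|)$ be a complex Banach space of functions or distributions on $M$ that contains the constant functions and on which integration $\nu_0(f)=\int f\,dm_0$ is a bounded linear functional. Here the elements of $V$ are regarded as linear functionals $f:m\mapsto\langle f,m\rangle$ on a linear space $\mathcal T\ni m_0$ of complex test measures on $M$ (a function $f$ acts by $m\mapsto\int f\,dm$; the constant $1$ is $m\mapsto m(M)$); $\nu_0(f)=\langle f,m_0\rangle$, and $1_Af$ is the functional $m\mapsto\langle f,m|_A\rangle$, where $m|_A\in\mathcal T$ is required. Let $P_0:V\to V$ be a bounded Perron–Frobenius operator of $T$ with respect to $m_0$, that is, $\langle P_0f,\,h\,m_0\rangle=\langle f,\,(h\circ T)\,m_0\rangle$ for all $f\in V$ and all bounded measurable $h:M\to\mathbb C$ with $h\,m_0\in\mathcal T$ (and then $(h\circ T)\,m_0\in\mathcal T$). For $\varepsilon\in E$ let $P_\varepsilon$ be the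 bounded operator $P_\varepsilon f=P_0(1_{M\setminus A_\varepsilon}f)$; for $\varepsilon=0$ this is required to be $P_0$ itself (for example $A_0=\emptyset$). Assume that we are in a REPFO (rare event Perron–Frobenius operator) setting, that is: (mixing) There are $\varphi_0\in V$ and a bounded operator $Q_0$ on $V$ of spectral radius $<1$ with $P_0=\varphi_0\otimes\nu_0+Q_0$, $P_0\varphi_0=\varphi_0$, $\nu_0P_0=\nu_0$, $Q_0\varphi_0=0$, $\nu_0Q_0=0$, where $(\varphi\otimes\nu)(f)=\nu(f)\varphi$. (i) There are a seminorm $|\cdot|_w\le\|\cdot\|$ on $V$, constants $\alpha\in(0,1)$, $D>0$ and a function $\pi:E\to[0,\infty)$ with $\lim_{\varepsilon\to0}\pi_\varepsilon=0$ such that for all $\varepsilon\in E$, $f\in V$, $n\in\mathbb N$: the residual spectrum of $P_\varepsilon$ (those $z\in\mathbb C$ for which $z-P_\varepsilon$ is injective with non-dense range) lies in $\{|z|\le\alpha\}$; $|P_\varepsilon^nf|_w\le D|f|_w$; $\|P_\varepsilon^nf\|\le D\alpha^n\|f\|+D|f|_w$; and $|P_\varepsilon f-P_0f|_w\le\pi_\varepsilon\|f\|$.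 (ii) $1_{A_\varepsilon}f\in V$ for all $f\in V$ and $\varepsilon\in E$. (iii) There is a constant $C$ with $|\nu_0(1_{A_\varepsilon}f)|\cdot\|1_{A_\varepsilon}\varphi_0\|\le C\,\|f\|\cdot|\nu_0(1_{A_\varepsilon}\varphi_0)|$ for all $f\in V$, $\varepsilon\in E$. Proposition. In a REPFO setting the eigenvalue perturbation assumptions (A1)–(A6) are satisfied for parameters close to $0$. That is, there are a neighbourhood $N$ of $0$ in $E$ and, for each $\varepsilon$, $\lambda_\varepsilon\in\mathbb C$, $\varphi_\varepsilon\in V$, a bounded linear functional $\nu_\varepsilon$ on $V$ and a bounded operator $Q_\varepsilon$ on $V$, which for $\varepsilon=0$ are $\lambda_0=1$ and the given $\varphi_0,\nu_0,Q_0$, such that (A1) $\lambda_\varepsilon\ne0$ and $\lambda_\varepsilon^{-1}P_\varepsilon=\varphi_\varepsilon\otimes\nu_\varepsilon+Q_\varepsilon$ for all $\varepsilon\in N$; (A2) $P_\varepsilon\varphi_\varepsilon=\lambda_\varepsilon\varphi_\varepsilon$, $\nu_\varepsilon P_\varepsilon=\lambda_\varepsilon\nu_\varepsilon$, $Q_\varepsilon\varphi_\varepsilon=0$,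 $\nu_\varepsilon Q_\varepsilon=0$ for all $\varepsilon\in N$; (A3) $\sum_{n=0}^\infty\sup_{\varepsilon\in N}\|Q_\varepsilon^n\|<\infty$; (A4) there is $C_2>0$ with $\nu_0(\varphi_\varepsilon)=1$ and $\|\varphi_\varepsilon\|\le C_2$ for all $\varepsilon\in N$; (A5) $\lim_{\varepsilon\to0}\|\nu_0(P_0-P_\varepsilon)\|=0$; (A6) there is a constant $C'$ with $\|\nu_0(P_0-P_\varepsilon)\|\cdot\|(P_0-P_\varepsilon)\varphi_0\|\le C'\,|\Delta_\varepsilon|$ for all $\varepsilon\in E$, where $\Delta_\varepsilon=\nu_0(P_0-P_\varepsilon)(\varphi_0)$. -/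

import Mathlib

open Filter Topology MeasureTheory
open scoped ENNReal

/-! ### Spaces of generalised functions -/

/-- A realisation of the vector space `V` as a space of functions or distributions on `M` that
contains the constant functions. A generalised function is, as usual, a linear functional on a
space `test` of test measures (test densities); a function `f` is the functional `m ↦ ∫ f dm`.
* Spaces of pointwise defined functions: `test` contains the Dirac measures.
* Spaces of `ν`-integrable functions modulo null sets: `test` consists of the measures `h ν` with
  `h` bounded and measurable.
* Spaces of distributions: `test` is smaller, so that the functionals may be more singular. -/
structure GenFunSpace (M : Type*) [MeasurableSpace M]
    (V : Type*) [AddCommGroup V] [Module ℂ V] where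
  /-- the test measures -/
  test : Submodule ℂ (ComplexMeasure M)
  /-- `pair f m` is the value of the generalised function `f` at the test measure `m` -/
  pair : V →ₗ[ℂ] (test →ₗ[ℂ] ℂ)
  /-- an element of `V` is determined by its values, so `V` is a space of functionals -/
  pair_injective : Function.Injective pair
  /-- the constant function `1` belongs to `V` -/
  one_mem : ∃ u : V, ∀ m : test, pair u m = (m : ComplexMeasure M) Set.univ

namespace GenFunSpace

variable {M : Type*} [MeasurableSpace M] {V : Type*} [AddCommGroup V] [Module ℂ V]

/-- `g = 1_B · f`: the value of `g` at a test measure is the value of `f` at its restriction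
to `B` (which has to be a test measure again). -/
def IsIndicatorMul (G : GenFunSpace M V) (B : Set M) (f g : V) : Prop :=
  ∀ m : G.test, ∃ hm : (m : ComplexMeasure M).restrict B ∈ G.test,
    G.pair g m = G.pair f ⟨(m : ComplexMeasure M).restrict B, hm⟩

theorem IsIndicatorMul.unique {G : GenFunSpace M V} {B : Set M} {f g g' : V}
    (h : G.IsIndicatorMul B f g) (h' : G.IsIndicatorMul B f g') : g = g' := by
  apply G.pair_injective
  ext m
  obtain ⟨_, e⟩ := h m
  obtain ⟨_, e'⟩ := h' m
  rw [e, e']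

open Classical in
/-- The product `1_B · f`, as an element of `V` (with the value `0` if it is not in `V`). -/
noncomputable def indicatorMul (G : GenFunSpace M V) (B : Set M) (f : V) : V :=
  if h : ∃ g : V, G.IsIndicatorMul B f g then h.choose else 0

theorem IsIndicatorMul.eq {G : GenFunSpace M V} {B : Set M} {f g : V}
    (h : G.IsIndicatorMul B f g) : G.indicatorMul B f = g := by
  have h' : ∃ g : V, G.IsIndicatorMul B f g := ⟨g, h⟩
  rw [indicatorMul, dif_pos h']
  exact h'.choose_spec.unique h

/-- If `1_B · f` is in `V`, then so is `1_{M ∖ B} · f = f - 1_B · f`. -/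
theorem IsIndicatorMul.compl {G : GenFunSpace M V} {B : Set M} (hB : MeasurableSet B) {f g : V}
    (h : G.IsIndicatorMul B f g) : G.IsIndicatorMul Bᶜ f (f - g) := by
  intro m
  obtain ⟨hm, e⟩ := h m
  have hr : (m : ComplexMeasure M).restrict Bᶜ
      = (m : ComplexMeasure M) - (m : ComplexMeasure M).restrict B := by
    rw [eq_sub_iff_add_eq, add_comm]
    exact VectorMeasure.restrict_add_restrict_compl hB
  have hm' : (m : ComplexMeasure M).restrict Bᶜ ∈ G.test := by
    rw [hr]; exact G.test.sub_mem m.2 hm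
  refine ⟨hm', ?_⟩
  have hs : (⟨(m : ComplexMeasure M).restrict Bᶜ, hm'⟩ : G.test)
      = m - ⟨(m : ComplexMeasure M).restrict B, hm⟩ := Subtype.ext hr
  rw [hs, map_sub (G.pair f), map_sub G.pair, LinearMap.sub_apply, e]

/-- `ν` is the functional on `V` given by the finite measure `m₀`: integration with respect
to `m₀`, i.e. the value at the test measure `m₀`. -/
def IsIntegration (G : GenFunSpace M V) (m₀ : Measure M) (ν : V → ℂ) : Prop :=
  ∃ h₀ : m₀.withDensityᵥ (fun _ ↦ (1 : ℂ)) ∈ G.test,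
    ∀ f : V, ν f = G.pair f ⟨m₀.withDensityᵥ (fun _ ↦ (1 : ℂ)), h₀⟩

/-- `P` is a Perron-Frobenius operator on `V` of `T : M → M` with respect to the finite reference
measure `m₀`: it is dual to composition with `T`,
`∫ P f · h dm₀ = ∫ f · h ∘ T dm₀` for all bounded measurable `h` with `h m₀` a test measure. -/
def IsPerronFrobenius (G : GenFunSpace M V) (T : M → M) (m₀ : Measure M) (P : V → V) : Prop :=
  ∀ h : M → ℂ, Measurable h → (∃ K : ℝ, ∀ x, ‖h x‖ ≤ K) →
    ∀ hh : m₀.withDensityᵥ h ∈ G.test,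
      ∃ hT : m₀.withDensityᵥ (h ∘ T) ∈ G.test,
        ∀ f : V, G.pair (P f) ⟨m₀.withDensityᵥ h, hh⟩ = G.pair f ⟨m₀.withDensityᵥ (h ∘ T), hT⟩

end GenFunSpace

/-! ### Spectral assumptions on a family of operators -/

section Families

variable {V : Type*} [NormedAddCommGroup V] [NormedSpace ℂ V]

/-- The residual spectrum of `P`: those `z` for which `z - P` is injective with non-dense range. -/
def residualSpectrum (P : V →L[ℂ] V) : Set ℂ :=
  {z : ℂ | Function.Injective (fun f : V ↦ z • f - P f) ∧ ¬ DenseRange (fun f : V ↦ z • f - P f)}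

/-- The rank one operator `φ ⊗ ν : f ↦ ν(f) φ`. -/
noncomputable def rankOneOp (φ : V) (ν : V →L[ℂ] ℂ) : V →L[ℂ] V := ν.smulRight φ

/-- The relations `P φ = lam φ`, `ν P = lam ν`, `Q φ = 0`, `ν Q = 0`. -/
structure EigenRelations (P : V →L[ℂ] V) (lam : ℂ) (φ : V) (ν : V →L[ℂ] ℂ)
    (Q : V →L[ℂ] V) : Prop where
  apply_eigenvector : P φ = lam • φ
  comp_eigenfunctional : ν.comp P = lam • ν
  remainder_apply : Q φ = 0
  comp_remainder : ν.comp Q = 0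

/-- Operator mixing condition: `P = φ ⊗ ν + Q`, with the eigenrelations for the eigenvalue `1`,
where `Q` has spectral radius strictly smaller than `1`. -/
structure OperatorMixing (P : V →L[ℂ] V) (φ : V) (ν : V →L[ℂ] ℂ) (Q : V →L[ℂ] V) : Prop where
  decomposition : P = rankOneOp φ ν + Q
  relations : EigenRelations P 1 φ ν Q
  spectralRadius_lt : spectralRadius ℂ Q < 1

variable {E : Type*} [TopologicalSpace E] [Zero E]

/-- The assumptions of the spectral perturbation theorem, uniform over the family `P`, for the
weak seminorm `w`, the constants `α`, `D` and the modulus of closeness `π`. -/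
structure UniformSpectralBounds (P : E → V →L[ℂ] V) (w : Seminorm ℂ V) (α D : ℝ)
    (π : E → ℝ) : Prop where
  alpha_pos : 0 < α
  alpha_lt_one : α < 1
  D_pos : 0 < D
  weak_le_norm : ∀ f : V, w f ≤ ‖f‖
  residual : ∀ ε : E, residualSpectrum (P ε) ⊆ {z : ℂ | ‖z‖ ≤ α}
  weak_bound : ∀ (ε : E) (f : V) (n : ℕ), w ((P ε ^ n) f) ≤ D * w f
  strong_bound : ∀ (ε : E) (f : V) (n : ℕ), ‖(P ε ^ n) f‖ ≤ D * α ^ n * ‖f‖ + D * w f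
  pi_nonneg : ∀ ε : E, 0 ≤ π ε
  pi_tendsto : Tendsto π (𝓝[≠] 0) (𝓝 0)
  close : ∀ (ε : E) (f : V), w (P ε f - P 0 f) ≤ π ε * ‖f‖

/-! ### The eigenvalue perturbation assumptions

They concern a family `P` and families `lam`, `φ`, `ν`, `Q` of eigenvalues, eigenvectors,
eigenfunctionals and remainders, for parameters in a set `S`. -/

/-- `lam_ε⁻¹ P_ε = φ_ε ⊗ ν_ε + Q_ε`, with `lam_ε ≠ 0` and `lam_0 = 1`. -/
def AssumptionA1 (S : Set E) (P : E → V →L[ℂ] V) (lam : E → ℂ) (φ : E → V)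
    (ν : E → V →L[ℂ] ℂ) (Q : E → V →L[ℂ] V) : Prop :=
  lam 0 = 1 ∧ ∀ ε ∈ S, lam ε ≠ 0 ∧ (lam ε)⁻¹ • P ε = rankOneOp (φ ε) (ν ε) + Q ε

/-- The eigenrelations for every parameter. -/
def AssumptionA2 (S : Set E) (P : E → V →L[ℂ] V) (lam : E → ℂ) (φ : E → V)
    (ν : E → V →L[ℂ] ℂ) (Q : E → V →L[ℂ] V) : Prop :=
  ∀ ε ∈ S, EigenRelations (P ε) (lam ε) (φ ε) (ν ε) (Q ε)

/-- `∑ₙ sup_ε ‖Q_ε ^ n‖ < ∞`, as a sum of suprema in `[0, ∞]`. -/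
def AssumptionA3 (S : Set E) (Q : E → V →L[ℂ] V) : Prop :=
  ∑' n : ℕ, ⨆ ε ∈ S, ‖Q ε ^ n‖ₑ < ∞

/-- `ν_0(φ_ε) = 1` and `‖φ_ε‖ ≤ C₂` for every parameter. -/
def AssumptionA4 (S : Set E) (φ : E → V) (ν : E → V →L[ℂ] ℂ) : Prop :=
  ∃ C₂ : ℝ, 0 < C₂ ∧ ∀ ε ∈ S, ν 0 (φ ε) = 1 ∧ ‖φ ε‖ ≤ C₂

/-- `Δ_ε = ν_0 (P_0 - P_ε) φ_0`. -/
noncomputable def perturbationSize (P : E → V →L[ℂ] V) (φ : E → V) (ν : E → V →L[ℂ] ℂ) (ε : E) :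
    ℂ :=
  ν 0 ((P 0 - P ε) (φ 0))

/-- `‖ν_0 (P_0 - P_ε)‖ → 0` as `ε → 0`. -/
def AssumptionA5 (P : E → V →L[ℂ] V) (ν : E → V →L[ℂ] ℂ) : Prop :=
  Tendsto (fun ε ↦ ‖(ν 0).comp (P 0 - P ε)‖) (𝓝 0) (𝓝 0)

/-- `‖ν_0 (P_0 - P_ε)‖ ‖(P_0 - P_ε) φ_0‖ ≤ const |Δ_ε|` for every parameter. -/
def AssumptionA6 (S : Set E) (P : E → V →L[ℂ] V) (φ : E → V) (ν : E → V →L[ℂ] ℂ) : Prop :=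
  ∃ C : ℝ, ∀ ε ∈ S,
    ‖(ν 0).comp (P 0 - P ε)‖ * ‖(P 0 - P ε) (φ 0)‖ ≤ C * ‖perturbationSize P φ ν ε‖

/-- Rare event Perron-Frobenius operators. `V` is a space of generalised functions on `M`
(through `G`), `P 0` is the Perron-Frobenius operator of `T` with respect to the reference measure
`m₀`, `ν₀` is integration with respect to `m₀`, the mixing condition is `P 0 = φ₀ ⊗ ν₀ + Q₀`,
and `P ε` is the operator with the hole `A ε`. The field `hole` for `ε = 0` says that the hole
`A 0` (usually empty or null) does not affect the unperturbed operator. -/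
structure IsREPFO {M : Type*} [MeasurableSpace M] (G : GenFunSpace M V) (T : M → M)
    (m₀ : Measure M) (A : E → Set M) (P : E → V →L[ℂ] V) (φ₀ : V) (ν₀ : V →L[ℂ] ℂ)
    (Q₀ : V →L[ℂ] V) : Prop where
  measurable_map : Measurable T
  measurableSet_hole : ∀ ε : E, MeasurableSet (A ε)
  integration : G.IsIntegration m₀ ν₀
  perronFrobenius : G.IsPerronFrobenius T m₀ (P 0)
  mixing : OperatorMixing (P 0) φ₀ ν₀ Q₀
  /-- `P_ε f = P_0 (1_{M ∖ A_ε} f)` -/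
  hole : ∀ (ε : E) (f : V), P ε f = P 0 (G.indicatorMul (A ε)ᶜ f)
  spectral : ∃ (w : Seminorm ℂ V) (α D : ℝ) (π : E → ℝ), UniformSpectralBounds P w α D π
  /-- `1_{A_ε} f ∈ V` for all `f ∈ V` -/
  indicator_mem : ∀ (ε : E) (f : V), ∃ g : V, G.IsIndicatorMul (A ε) f g
  /-- `|ν_0 (1_{A_ε} f)| ‖1_{A_ε} φ_0‖ ≤ const ‖f‖ |ν_0 (1_{A_ε} φ_0)|` -/
  rare : ∃ C : ℝ, ∀ (ε : E) (f : V),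
    ‖ν₀ (G.indicatorMul (A ε) f)‖ * ‖G.indicatorMul (A ε) φ₀‖
      ≤ C * ‖f‖ * ‖ν₀ (G.indicatorMul (A ε) φ₀)‖

end Families

/-! Everything is read off from the remainders `B = P ε - rankOneOp φ₀ ν₀`, which equal `Q₀` at `ε =
0`. Two uniform facts near `0` suffice: some fixed power of `B` has norm at most `1 / 2`, and the
functional `ℓ = ν₀ B` has small norm. The second holds because mixing and the Lasota-Yorke bounds
make `ν₀` bounded for the weak seminorm (`OperatorMixing.exists_eigenfunctional_le_seminorm`), while
`ν₀ B = ν₀ (P ε - P 0)`. The first follows from the Lasota-Yorke inequality, the decay of `Q₀ ^ n`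
and strong-to-weak closeness (`exists_forall_norm_pow_sub_rankOneOp_le_half`). Given both, no
contour integrals are needed. With `lam = 1 + ℓ φ`, the eigenvector equation normalised by `ν₀ φ =
1` is `(1 - B) φ = φ₀ - ℓ(φ) φ`, solved by contraction. Modulo `φ`, `lam⁻¹ P ε` acts as an operator
`y` close to `B`; inverting `1 - y` gives the eigenfunctional, and powers of `y` control those of
`Q` (`exists_eigenRelations_of_small`). (A5) is the smallness of `ν₀ B`; (A6) is the rare event
condition (iii) read through `P 0 - P ε = P 0 ∘ 1_A`. -/

/-! ### Powers and Neumann series with uniform bounds -/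

section NormedRing

variable {R : Type*} [NormedRing R] [NormOneClass R]

theorem norm_pow_sub_pow_le {K : ℝ} (hK : 1 ≤ K) {a b : R} (ha : ‖a‖ ≤ K) (hb : ‖b‖ ≤ K) (n : ℕ) :
    ‖a ^ n - b ^ n‖ ≤ n * K ^ n * ‖a - b‖ := by
  induction n with
  | zero => simp
  | succ n ih =>
    have hK0 : 0 ≤ K := by linarith
    have e : a ^ (n + 1) - b ^ (n + 1) = (a ^ n - b ^ n) * a + b ^ n * (a - b) := by
      rw [pow_succ, pow_succ]; noncomm_ring
    have hbn : ‖b ^ n‖ ≤ K ^ (n + 1) :=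
      (norm_pow_le b n).trans ((pow_le_pow_left₀ (norm_nonneg b) hb n).trans
        (pow_le_pow_right₀ hK n.le_succ))
    calc ‖a ^ (n + 1) - b ^ (n + 1)‖
        ≤ ‖a ^ n - b ^ n‖ * ‖a‖ + ‖b ^ n‖ * ‖a - b‖ := by
          rw [e]
          exact (norm_add_le _ _).trans (add_le_add (norm_mul_le _ _) (norm_mul_le _ _))
      _ ≤ (n * K ^ n * ‖a - b‖) * K + K ^ (n + 1) * ‖a - b‖ := by gcongr
      _ = ((n + 1 : ℕ) : ℝ) * K ^ (n + 1) * ‖a - b‖ := by push_cast; ring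

/-- If `‖b‖ ≤ K` and `‖b ^ N‖ ≤ q < 1`, then `1 - b` is invertible, with an inverse bounded in terms
of `K`, `N` and `q` only. -/
theorem exists_inverse_one_sub_of_norm_pow_le [CompleteSpace R] {K q : ℝ} (hK : 0 ≤ K)
    (hq : q < 1) {N : ℕ} {b : R} (hb : ‖b‖ ≤ K) (hbN : ‖b ^ N‖ ≤ q) :
    ∃ s : R, s * (1 - b) = 1 ∧ (1 - b) * s = 1 ∧
      ‖s‖ ≤ (∑ k ∈ Finset.range N, K ^ k) * (1 - q)⁻¹ := by
  have h1 : ‖b ^ N‖ < 1 := hbN.trans_lt hq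
  -- Since `1 - b ^ N = (1 - b) g`, the inverse is `g` times the Neumann series of `b ^ N`.
  set g := ∑ k ∈ Finset.range N, b ^ k with hg
  set t := ∑' n : ℕ, (b ^ N) ^ n with ht
  have hg1 : g * (1 - b) = 1 - b ^ N := geom_sum_mul_neg b N
  have hg2 : (1 - b) * g = 1 - b ^ N := mul_neg_geom_sum b N
  have ht1 : t * (1 - b ^ N) = 1 := geom_series_mul_neg _ h1
  have ht2 : (1 - b ^ N) * t = 1 := mul_neg_geom_series _ h1
  have e : g * t = t * g := by
    have hc : g * (1 - b ^ N) = (1 - b ^ N) * g := by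
      nth_rewrite 1 [← hg2]; rw [← mul_assoc, hg1]
    calc g * t = t * ((1 - b ^ N) * g) * t := by rw [← mul_assoc, ht1, one_mul]
      _ = t * g * ((1 - b ^ N) * t) := by rw [← hc]; simp only [mul_assoc]
      _ = t * g := by rw [ht2, mul_one]
  refine ⟨g * t, ?_, ?_, ?_⟩
  · rw [e, mul_assoc, hg1, ht1]
  · rw [← mul_assoc, hg2, ht2]
  · have n1 : ‖g‖ ≤ ∑ k ∈ Finset.range N, K ^ k :=
      norm_sum_le_of_le _ fun k _ ↦
        (norm_pow_le b k).trans (pow_le_pow_left₀ (norm_nonneg b) hb k)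
    have n2 : ‖t‖ ≤ (1 - q)⁻¹ := by
      have := tsum_geometric_le_of_norm_lt_one (b ^ N) h1
      rw [norm_one, sub_self, zero_add] at this
      exact this.trans (inv_anti₀ (by linarith) (by linarith))
    exact (norm_mul_le _ _).trans (mul_le_mul n1 n2 (norm_nonneg _)
      (Finset.sum_nonneg fun k _ ↦ pow_nonneg hK k))

/-- Division of `n` by `N` gives the majorant `K ^ N * q ^ (n / N)`. It is chosen before `b`, which
is what puts the supremum inside the sum in (A3). -/
theorem exists_summable_norm_pow_le {K q : ℝ} (hK : 1 ≤ K) (hq0 : 0 ≤ q) (hq : q < 1) {N : ℕ}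
    (hN : 0 < N) :
    ∃ c : ℕ → ℝ, (∀ n, 0 ≤ c n) ∧ Summable c ∧
      ∀ b : R, ‖b‖ ≤ K → ‖b ^ N‖ ≤ q → ∀ n, ‖b ^ n‖ ≤ c n := by
  have hK0 : 0 ≤ K := by linarith
  have : NeZero N := ⟨hN.ne'⟩
  refine ⟨fun n ↦ K ^ N * q ^ (n / N), fun n ↦ by positivity, ?_, ?_⟩
  · apply Summable.mul_left
    rw [← (Nat.divModEquiv N).symm.summable_iff, summable_prod_of_nonneg (fun _ ↦ by
      simp only [Function.comp, Pi.zero_apply]; positivity)]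
    have hd : ∀ (x : ℕ) (y : Fin N), (x * N + y) / N = x := fun x y ↦ by
      rw [mul_comm, Nat.mul_add_div hN, Nat.div_eq_of_lt y.2, add_zero]
    refine ⟨fun x ↦ Summable.of_finite, ?_⟩
    simp only [Function.comp, Nat.divModEquiv_symm_apply, hd, tsum_fintype, Finset.sum_const]
    simpa using (summable_geometric_of_lt_one hq0 hq).mul_left (N : ℝ)
  · intro b hb hbN n
    calc ‖b ^ n‖ = ‖b ^ (n % N) * (b ^ N) ^ (n / N)‖ := by
          rw [← pow_mul, ← pow_add, Nat.mod_add_div]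
      _ ≤ ‖b‖ ^ (n % N) * ‖b ^ N‖ ^ (n / N) :=
          (norm_mul_le _ _).trans (mul_le_mul (norm_pow_le _ _) (norm_pow_le _ _)
            (norm_nonneg _) (by positivity))
      _ ≤ K ^ N * q ^ (n / N) := by
          refine mul_le_mul ?_ (pow_le_pow_left₀ (norm_nonneg _) hbN _) (by positivity)
            (by positivity)
          exact (pow_le_pow_left₀ (norm_nonneg _) hb _).trans
            (pow_le_pow_right₀ hK (Nat.mod_lt n hN).le)

end NormedRing

/-! ### Rank-one perturbations -/

section RankOne

variable {V : Type*} [NormedAddCommGroup V] [NormedSpace ℂ V]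

@[simp] theorem rankOneOp_apply (φ : V) (ν : V →L[ℂ] ℂ) (f : V) : rankOneOp φ ν f = ν f • φ := rfl

theorem norm_rankOneOp (φ : V) (ν : V →L[ℂ] ℂ) : ‖rankOneOp φ ν‖ = ‖φ‖ * ‖ν‖ := by
  rw [rankOneOp, ContinuousLinearMap.norm_smulRight_apply, mul_comm]

/-- Discrete Duhamel formula: with `B = P - φ ⊗ ν`, `P^j B^m g = P^(j+m) g - ∑_{k<m} ν(B^k g)
P^(j+m-1-k) φ`. It transfers estimates from `P` to `B`. -/
theorem norm_le_of_norm_le_of_le_rankOneOp {P : V →L[ℂ] V} {φ : V} {ν : V →L[ℂ] ℂ} {c : ℝ}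
    (hP : ∀ n, ‖P ^ n‖ ≤ c) (g : V) (m : ℕ) :
    ∀ j, ‖(P ^ j) (((P - rankOneOp φ ν) ^ m) g)‖ ≤ ‖(P ^ (j + m)) g‖
      + ∑ k ∈ Finset.range m, c * ‖φ‖ * ‖ν (((P - rankOneOp φ ν) ^ k) g)‖ := by
  induction m with
  | zero => simp
  | succ m ih =>
    intro j
    set B := P - rankOneOp φ ν with hB
    have e : (P ^ j) ((B ^ (m + 1)) g) = (P ^ (j + 1)) ((B ^ m) g) - ν ((B ^ m) g) • (P ^ j) φ := by
      rw [pow_succ' B, pow_succ P, mul_apply_eq_comp, mul_apply_eq_comp]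
      rw [← map_smul, ← map_sub]
      rfl
    have h2 : ‖ν ((B ^ m) g) • (P ^ j) φ‖ ≤ c * ‖φ‖ * ‖ν ((B ^ m) g)‖ := by
      rw [norm_smul, mul_comm]
      gcongr
      exact ((P ^ j).le_opNorm φ).trans (mul_le_mul_of_nonneg_right (hP j) (norm_nonneg _))
    rw [e, Finset.sum_range_succ, ← add_assoc, show j + (m + 1) = j + 1 + m by omega]
    exact (norm_sub_le _ _).trans (add_le_add (ih (j + 1)) h2)

end RankOne

/-! ### Eigenvector by contraction, and the spectral splitting -/

section FixedPoint

variable {V : Type*} [NormedAddCommGroup V] [NormedSpace ℂ V] [CompleteSpace V]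

/-- The quadratic equation `φ = s (φ₀ - ℓ(φ) φ)` is solvable if the functional `ℓ` is small. -/
theorem exists_solution_quadratic {s : V →L[ℂ] V} {ℓ : V →L[ℂ] ℂ} {φ₀ : V} {K r η : ℝ}
    (hs : ‖s‖ ≤ K) (hr : 0 ≤ r) (hℓ : ‖ℓ‖ ≤ η) (h₁ : K * (‖φ₀‖ + η * r * r) ≤ r)
    (h₂ : K * (2 * η * r) ≤ 1 / 2) :
    ∃ φ : V, ‖φ‖ ≤ r ∧ s (φ₀ - ℓ φ • φ) = φ := by
  have hK : 0 ≤ K := (norm_nonneg _).trans hs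
  have hη : 0 ≤ η := (norm_nonneg _).trans hℓ
  set F : V → V := fun f ↦ s (φ₀ - ℓ f • f) with hF
  have hsle : ∀ f, ‖s f‖ ≤ K * ‖f‖ := fun f ↦
    (s.le_opNorm f).trans (mul_le_mul_of_nonneg_right hs (norm_nonneg _))
  have hℓle : ∀ f, ‖ℓ f‖ ≤ η * ‖f‖ := fun f ↦
    (ℓ.le_opNorm f).trans (mul_le_mul_of_nonneg_right hℓ (norm_nonneg _))
  have hmaps : Set.MapsTo F (Metric.closedBall 0 r) (Metric.closedBall 0 r) := by
    intro f hf
    rw [mem_closedBall_zero_iff] at hf ⊢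
    refine (hsle _).trans (le_trans ?_ h₁)
    gcongr
    refine (norm_sub_le _ _).trans ?_
    gcongr
    rw [norm_smul]
    have := hℓle f
    gcongr
    exact this.trans (by gcongr)
  have hc : ContractingWith (1 / 2) (hmaps.restrict F _ _) := by
    refine ⟨by norm_num, LipschitzWith.of_dist_le_mul ?_⟩
    rintro ⟨f, hf⟩ ⟨g, hg⟩
    rw [mem_closedBall_zero_iff] at hf hg
    rw [Subtype.dist_eq, Subtype.dist_eq, dist_eq_norm, dist_eq_norm]
    have e : F f - F g = - s (ℓ (f - g) • f + ℓ g • (f - g)) := by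
      simp only [hF, ← map_sub, ← map_neg]
      congr 1
      rw [map_sub ℓ]
      module
    change ‖F f - F g‖ ≤ _ * ‖f - g‖
    rw [e, norm_neg]
    have h3 : ‖ℓ (f - g) • f + ℓ g • (f - g)‖ ≤ 2 * η * r * ‖f - g‖ := by
      refine (norm_add_le _ _).trans ?_
      rw [norm_smul, norm_smul]
      have i1 : ‖ℓ (f - g)‖ * ‖f‖ ≤ (η * ‖f - g‖) * r := by
        gcongr; exact hℓle _
      have i2 : ‖ℓ g‖ * ‖f - g‖ ≤ (η * r) * ‖f - g‖ := by
        gcongr; exact (hℓle g).trans (by gcongr)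
      linarith
    calc ‖s _‖ ≤ K * (2 * η * r * ‖f - g‖) := (hsle _).trans (by gcongr)
      _ = K * (2 * η * r) * ‖f - g‖ := by ring
      _ ≤ ((1 / 2 : NNReal) : ℝ) * ‖f - g‖ := by
        gcongr
        simpa using h₂
  obtain ⟨φ, hφ, hfix, -⟩ := hc.exists_fixedPoint' Metric.isClosed_closedBall.isComplete hmaps
    (x := 0) (by simpa using hr) (edist_ne_top _ _)
  exact ⟨φ, by simpa using hφ, hfix⟩

end FixedPoint

section Splitting

variable {V : Type*} [NormedAddCommGroup V] [NormedSpace ℂ V]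

/-- Algebraic form of the spectral splitting of `P = B + φ₀ ⊗ ν₀`, in terms of an eigenvector `φ` of
`P` and of an inverse `t` of `1 - y`, where `lam y = B - φ ⊗ ν₀ B` is the action of `P` modulo `φ`. -/
theorem eigenRelations_of_inverse {P B y t : V →L[ℂ] V} {φ₀ φ : V} {ν₀ ℓ ν : V →L[ℂ] ℂ} {lam : ℂ}
    (hB : P = B + rankOneOp φ₀ ν₀) (hν₀ : ν₀ φ₀ = 1) (hℓ : ν₀.comp B = ℓ)
    (hφ : P φ = lam • φ) (hνφ : ν₀ φ = 1) (hlam : lam = 1 + ℓ φ) (hlam0 : lam ≠ 0)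
    (hy : y = lam⁻¹ • (B - rankOneOp φ ℓ)) (ht : t * (1 - y) = 1)
    (hν : ν = ν₀ + lam⁻¹ • ℓ.comp (t * (1 - rankOneOp φ ν₀))) :
    EigenRelations P lam φ ν (lam⁻¹ • P - rankOneOp φ ν) ∧
      ∀ n : ℕ, (lam⁻¹ • P - rankOneOp φ ν) ^ (n + 1)
        = (1 - rankOneOp φ ν) * y ^ (n + 1) * (1 - rankOneOp φ ν₀) := by
  have hPa : ∀ f, P f = B f + ν₀ f • φ₀ := fun f ↦ by rw [hB]; rfl
  have hℓa : ∀ f, ν₀ (B f) = ℓ f := fun f ↦ by rw [← hℓ]; rfl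
  have hya : ∀ f, lam • y f = B f - ℓ f • φ := fun f ↦ by
    rw [hy]; simp [smul_smul, hlam0]
  have hνa : ∀ f, ν f = ν₀ f + lam⁻¹ * ℓ (t (f - ν₀ f • φ)) := fun f ↦ by rw [hν]; simp
  have hta : ∀ f, t (y f) = t f - f := fun f ↦ by
    have := DFunLike.congr_fun ht f
    simp only [mul_apply_eq_comp, sub_apply,
      one_apply_eq_self, map_sub] at this
    exact eq_sub_iff_add_eq'.mpr (sub_eq_iff_eq_add.mp this).symm
  have hφ1 : ν φ = 1 := by rw [hνa, hνφ]; simp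
  -- With the projection `R = 1 - φ ⊗ ν₀` along `φ`, this is `R P = lam y R`.
  have hRP : ∀ f, P f - ν₀ (P f) • φ = lam • y (f - ν₀ f • φ) := fun f ↦ by
    have h0 : P f = B (f - ν₀ f • φ) + (ν₀ f * lam) • φ := by
      have : P (f - ν₀ f • φ) = B (f - ν₀ f • φ) := by rw [hPa]; simp [hνφ]
      rw [← this, map_sub, map_smul, hφ, smul_smul]; abel
    rw [hya, h0, map_add, map_smul, hνφ, hℓa]
    simp only [smul_eq_mul, mul_one]
    module
  -- Because `ν₀ P = lam ν₀ + ℓ R`, a functional `ν₀ + μ R` is an eigenfunctional as soon as `μ (1 -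
  -- y) = lam⁻¹ ℓ`; this dictates `μ = lam⁻¹ ℓ t`.
  have hνP : ∀ f, ν (P f) = lam * ν f := fun f ↦ by
    rw [hνa, hRP, map_smul, hta, hνa f, hPa, map_add, hℓa]
    simp only [map_smul, map_sub, hν₀, smul_eq_mul]
    field_simp
    rw [hlam]; ring
  have hQφ : (lam⁻¹ • P - rankOneOp φ ν) φ = 0 := by
    simp [hφ, hφ1, smul_smul, hlam0]
  have hrel : EigenRelations P lam φ ν (lam⁻¹ • P - rankOneOp φ ν) := by
    refine ⟨hφ, ?_, hQφ, ?_⟩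
    · ext f; simpa using hνP f
    · ext f; simp [hνP, hφ1, hlam0]
  have hQ : lam⁻¹ • P - rankOneOp φ ν = (1 - rankOneOp φ ν) * y * (1 - rankOneOp φ ν₀) := by
    ext f
    have e1 : y (f - ν₀ f • φ) = lam⁻¹ • (P f - ν₀ (P f) • φ) := by
      rw [hRP, smul_smul, inv_mul_cancel₀ hlam0, one_smul]
    change lam⁻¹ • P f - ν f • φ = y (f - ν₀ f • φ) - ν (y (f - ν₀ f • φ)) • φ
    rw [e1]
    simp only [map_smul, map_sub, hνP, hφ1, smul_eq_mul]
    match_scalars <;> field_simp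
    ring
  -- `R φ = 0` and `ν₀ y = 0`, so the inner projections cancel in powers of `Q`.
  have hcomm : (1 - rankOneOp φ ν₀) * ((1 - rankOneOp φ ν) * y) = y := by
    ext f
    have : ν₀ (y f) = 0 := by
      have := congrArg ν₀ (hya f)
      simpa [hℓa, hνφ, hlam0] using this
    simp [this, hνφ]
  refine ⟨hrel, fun n ↦ ?_⟩
  induction n with
  | zero => simpa using hQ
  | succ n ih =>
    rw [pow_succ, ih, hQ, pow_succ y (n + 1)]
    calc _ = (1 - rankOneOp φ ν) * y ^ (n + 1) *
          ((1 - rankOneOp φ ν₀) * ((1 - rankOneOp φ ν) * y)) * (1 - rankOneOp φ ν₀) := by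
          simp only [mul_assoc]
      _ = _ := by rw [hcomm]; simp only [mul_assoc]

end Splitting

section Perturbation

/-- In order, the conditions serve: invariance of the ball, contraction, `‖lam‖ ≥ 1 / 2`, the bound
on `ν`, `‖y - B‖ ≤ 1`, and `‖y ^ N - B ^ N‖ ≤ 1 / 4`. -/
theorem exists_pos_small (K₁ r K : ℝ) (N : ℕ) :
    ∃ η : ℝ, 0 < η ∧ K₁ * (η * r * r) ≤ 1 ∧ K₁ * (2 * η * r) ≤ 1 / 2 ∧ η * r ≤ 1 / 2 ∧
      η ≤ 1 ∧ 2 * η * r * (K + 1) ≤ 1 ∧ N * (K + 1) ^ N * (2 * η * r * (K + 1)) ≤ 1 / 4 := by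
  have key : ∀ a b : ℝ, 0 < b → ∀ᶠ η in 𝓝[>] (0 : ℝ), a * η ≤ b := fun a b hb ↦ by
    have : Tendsto (fun η : ℝ ↦ a * η) (𝓝[>] 0) (𝓝 0) := by
      have := (continuous_const_mul a).tendsto (0 : ℝ)
      rw [mul_zero] at this
      exact this.mono_left nhdsWithin_le_nhds
    exact this.eventually_le_const hb
  obtain ⟨η, hη, h1, h2, h3, h4, h5, h6⟩ := (eventually_mem_nhdsWithin.and
    ((key (K₁ * r * r) 1 one_pos).and ((key (K₁ * 2 * r) (1 / 2) (by norm_num)).and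
    ((key r (1 / 2) (by norm_num)).and ((key 1 1 one_pos).and
    ((key (2 * r * (K + 1)) 1 one_pos).and
    (key (N * (K + 1) ^ N * (2 * r * (K + 1))) (1 / 4) (by norm_num)))))))).exists
  exact ⟨η, hη, by linarith, by linarith, by linarith, by linarith, by linarith, by linarith⟩

variable {V : Type*} [NormedAddCommGroup V] [NormedSpace ℂ V]

/-- If `B` is a uniform eventual contraction, and if the functional `ν₀ B` is small, then
`B + φ₀ ⊗ ν₀` has an eigenvalue close to `1` with a spectral gap, with bounds that do not depend
on `B`. -/
theorem exists_eigenRelations_of_small [CompleteSpace V] {φ₀ : V} {ν₀ : V →L[ℂ] ℂ}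
    (hν₀ : ν₀ φ₀ = 1) {K : ℝ} (hK : 1 ≤ K) {N : ℕ} (hN : 0 < N) :
    ∃ η > 0, ∃ (r : ℝ) (c : ℕ → ℝ), 0 < r ∧ (∀ n, 0 ≤ c n) ∧ Summable c ∧
      ∀ B : V →L[ℂ] V, ‖B‖ ≤ K → ‖B ^ N‖ ≤ 1 / 2 → ‖ν₀.comp B‖ ≤ η →
        ∃ (lam : ℂ) (φ : V) (ν : V →L[ℂ] ℂ) (Q : V →L[ℂ] V), lam ≠ 0 ∧
          lam⁻¹ • (B + rankOneOp φ₀ ν₀) = rankOneOp φ ν + Q ∧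
          EigenRelations (B + rankOneOp φ₀ ν₀) lam φ ν Q ∧
          ν₀ φ = 1 ∧ ‖φ‖ ≤ r ∧ ∀ n, ‖Q ^ n‖ ≤ c n := by
  have hφ₀ : φ₀ ≠ 0 := by rintro rfl; simp at hν₀
  have : Nontrivial V := ⟨φ₀, 0, hφ₀⟩
  have hK0 : 0 ≤ K := by linarith
  -- `K + 1` and `3 / 4 = 1 / 2 + 1 / 4` are the bounds that `y` inherits from `B`.
  obtain ⟨c, hc0, hc, hcb⟩ := exists_summable_norm_pow_le (R := V →L[ℂ] V) (K := K + 1) (q := 3 / 4)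
    (by linarith) (by norm_num) (by norm_num) hN
  obtain ⟨K₁, hK₁⟩ : ∃ x : ℝ, x = (∑ k ∈ Finset.range N, K ^ k) * (1 - 1 / 2 : ℝ)⁻¹ := ⟨_, rfl⟩
  obtain ⟨K₂, hK₂⟩ : ∃ x : ℝ, x = (∑ k ∈ Finset.range N, (K + 1) ^ k) * (1 - 3 / 4 : ℝ)⁻¹ := ⟨_, rfl⟩
  have hK₁0 : 0 ≤ K₁ := by
    rw [hK₁]
    exact mul_nonneg (Finset.sum_nonneg fun k _ ↦ pow_nonneg hK0 k) (by norm_num)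
  have hK₂0 : 0 ≤ K₂ := by
    rw [hK₂]
    exact mul_nonneg (Finset.sum_nonneg fun k _ ↦ by positivity) (by norm_num)
  obtain ⟨r, hr⟩ : ∃ x : ℝ, x = K₁ * ‖φ₀‖ + 1 := ⟨_, rfl⟩
  have hr1 : 1 ≤ r := by
    have : 0 ≤ K₁ * ‖φ₀‖ := by positivity
    linarith
  have hr0 : 0 < r := by linarith
  obtain ⟨η, hη, hη1, hη2, hη3, hη4, hη5, hη6⟩ := exists_pos_small K₁ r K N
  obtain ⟨Cν, hCν⟩ : ∃ x : ℝ, x = ‖ν₀‖ + 2 * (1 * (K₂ * (1 + r * ‖ν₀‖))) := ⟨_, rfl⟩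
  obtain ⟨C, hC⟩ : ∃ x : ℝ, x = (1 + r * Cν) * (1 + r * ‖ν₀‖) := ⟨_, rfl⟩
  have hCν0 : 0 ≤ Cν := by rw [hCν]; positivity
  have hC0 : 0 ≤ C := by rw [hC]; positivity
  -- The factorisation through `y` covers only positive powers of `Q`; the extra `1` covers `Q ^ 0`.
  refine ⟨η, hη, r, fun n ↦ C * c n + if n = 0 then 1 else 0, hr0,
    fun n ↦ add_nonneg (mul_nonneg hC0 (hc0 n)) (by split_ifs <;> norm_num),
    (hc.mul_left C).add (summable_of_ne_finset_zero (s := {0}) fun n hn ↦ by simpa using hn), ?_⟩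
  intro B hB hBN hℓ
  obtain ⟨s, hs1, hs2, hsK⟩ := exists_inverse_one_sub_of_norm_pow_le hK0 (by norm_num) hB hBN
  set ℓ := ν₀.comp B with hℓdef
  obtain ⟨φ, hφr, hφ⟩ := exists_solution_quadratic (φ₀ := φ₀) (r := r) hsK hr0.le hℓ
    (by rw [mul_add, ← hK₁, hr]; rw [hr] at hη1; linarith) (hK₁ ▸ hη2)
  have hℓφ : ‖ℓ φ‖ ≤ η * r :=
    (ℓ.le_opNorm φ).trans (mul_le_mul hℓ hφr (norm_nonneg _) hη.le)
  have hℓa : ∀ f, ν₀ (B f) = ℓ f := fun f ↦ rfl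
  obtain ⟨lam, hlam⟩ : ∃ lam, lam = 1 + ℓ φ := ⟨_, rfl⟩
  have hlam2 : 1 / 2 ≤ ‖lam‖ := by
    have : ‖(1 : ℂ)‖ - ‖ℓ φ‖ ≤ ‖lam‖ := by rw [hlam]; exact norm_sub_le_norm_add _ _
    rw [norm_one] at this
    linarith
  have hlam0 : lam ≠ 0 := norm_pos_iff.mp (by linarith)
  have hlaminv : ‖lam⁻¹‖ ≤ 2 := by
    rw [norm_inv]; exact inv_le_of_inv_le₀ (by norm_num) (by linarith)
  have hfix : φ - B φ = φ₀ - ℓ φ • φ := by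
    have := DFunLike.congr_fun hs2 (φ₀ - ℓ φ • φ)
    rw [mul_apply_eq_comp, hφ] at this
    simpa using this
  -- Applying `ν₀` to the fixed point equation gives `lam * (ν₀ φ - 1) = 0`.
  have hνφ : ν₀ φ = 1 := by
    have := congrArg ν₀ hfix
    rw [map_sub, map_sub, map_smul, hℓa, hν₀, smul_eq_mul] at this
    have h2 : lam * (ν₀ φ - 1) = 0 := by rw [hlam]; linear_combination this
    simpa [hlam0, sub_eq_zero] using h2
  have hPφ : (B + rankOneOp φ₀ ν₀) φ = lam • φ := by
    have : B φ = φ - φ₀ + ℓ φ • φ := by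
      rw [← sub_sub_cancel φ (B φ), hfix]; abel
    rw [add_apply, this, rankOneOp_apply, hνφ, hlam]
    module
  obtain ⟨y, hy⟩ : ∃ x : V →L[ℂ] V, x = lam⁻¹ • (B - rankOneOp φ ℓ) := ⟨_, rfl⟩
  have hyB : ‖y - B‖ ≤ 2 * η * r * (K + 1) := by
    have e : y - B = lam⁻¹ • (-(ℓ φ) • B - rankOneOp φ ℓ) := by
      have : B = lam⁻¹ • (lam • B) := by rw [smul_smul, inv_mul_cancel₀ hlam0, one_smul]
      nth_rewrite 1 [this]
      rw [hy, ← smul_sub, hlam]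
      congr 1
      module
    rw [e, norm_smul]
    have h1 : ‖-(ℓ φ) • B - rankOneOp φ ℓ‖ ≤ η * r * K + r * η := by
      refine (norm_sub_le _ _).trans ?_
      rw [norm_smul, norm_neg, norm_rankOneOp]
      gcongr
    calc _ ≤ 2 * (η * r * K + r * η) := by gcongr
      _ = _ := by ring
  have hyK : ‖y‖ ≤ K + 1 := by
    have := norm_le_norm_add_norm_sub B y
    rw [norm_sub_rev] at this
    linarith
  have hyN : ‖y ^ N‖ ≤ 3 / 4 := by
    have h1 := norm_pow_sub_pow_le (by linarith : 1 ≤ K + 1) hyK (hB.trans (by linarith)) N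
    have h2 : ‖y ^ N - B ^ N‖ ≤ 1 / 4 := h1.trans (le_trans (by gcongr) hη6)
    have := norm_le_norm_add_norm_sub (B ^ N) (y ^ N)
    rw [norm_sub_rev] at this
    linarith
  obtain ⟨t, ht1, -, htK⟩ :=
    exists_inverse_one_sub_of_norm_pow_le (by linarith : 0 ≤ K + 1) (by norm_num) hyK hyN
  obtain ⟨ν, hν⟩ : ∃ x : V →L[ℂ] ℂ, x = ν₀ + lam⁻¹ • ℓ.comp (t * (1 - rankOneOp φ ν₀)) := ⟨_, rfl⟩
  obtain ⟨hrel, hpow⟩ := eigenRelations_of_inverse (P := B + rankOneOp φ₀ ν₀) rfl hν₀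
    hℓdef.symm hPφ hνφ hlam hlam0 hy ht1 hν
  have hproj : ∀ (μ : V →L[ℂ] ℂ) (k : ℝ), ‖μ‖ ≤ k → ‖1 - rankOneOp φ μ‖ ≤ 1 + r * k := by
    intro μ k hμ
    refine (norm_sub_le _ _).trans ?_
    rw [norm_one, norm_rankOneOp]
    gcongr
  have hνC : ‖ν‖ ≤ Cν := by
    rw [hν]
    refine (norm_add_le _ _).trans ?_
    rw [norm_smul]
    have h1 : ‖ℓ.comp (t * (1 - rankOneOp φ ν₀))‖ ≤ 1 * (K₂ * (1 + r * ‖ν₀‖)) := by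
      refine (ContinuousLinearMap.opNorm_comp_le _ _).trans ?_
      refine mul_le_mul (hℓ.trans hη4) ?_ (norm_nonneg _) zero_le_one
      exact (norm_mul_le _ _).trans (mul_le_mul (hK₂ ▸ htK) (hproj _ _ le_rfl) (norm_nonneg _) hK₂0)
    rw [hCν]
    gcongr
  refine ⟨lam, φ, ν, lam⁻¹ • (B + rankOneOp φ₀ ν₀) - rankOneOp φ ν, hlam0, by abel, hrel, hνφ, hφr,
    fun n ↦ ?_⟩
  cases n with
  | zero =>
    have := mul_nonneg hC0 (hc0 0)
    simpa using this
  | succ n =>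
    simp only [hpow, n.succ_ne_zero, if_false, add_zero, hC]
    calc _ ≤ (1 + r * Cν) * c (n + 1) * (1 + r * ‖ν₀‖) := by
          refine (norm_mul_le _ _).trans (mul_le_mul ?_ (hproj _ _ le_rfl) (norm_nonneg _)
            (mul_nonneg (by positivity) (hc0 _)))
          exact (norm_mul_le _ _).trans (mul_le_mul (hproj _ _ hνC) (hcb y hyK hyN _)
            (norm_nonneg _) (by positivity))
      _ = _ := by ring

end Perturbation

/-! ### Uniform contraction of the remainders -/

section LasotaYorke

variable {V : Type*} [NormedAddCommGroup V] [NormedSpace ℂ V]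

/-- The Doeblin-Fortet-Lasota-Yorke inequalities for the powers of `P`. -/
structure LasotaYorke (w : Seminorm ℂ V) (α D : ℝ) (P : V →L[ℂ] V) : Prop where
  weak_bound : ∀ (f : V) (n : ℕ), w ((P ^ n) f) ≤ D * w f
  strong_bound : ∀ (f : V) (n : ℕ), ‖(P ^ n) f‖ ≤ D * α ^ n * ‖f‖ + D * w f

variable {w : Seminorm ℂ V} {α D : ℝ} {P P₀ : V →L[ℂ] V} {φ : V} {ν : V →L[ℂ] ℂ}

theorem LasotaYorke.norm_pow_le (h : LasotaYorke w α D P) (hw : ∀ f, w f ≤ ‖f‖) (hα0 : 0 ≤ α)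
    (hα1 : α ≤ 1) (hD : 0 ≤ D) (n : ℕ) : ‖P ^ n‖ ≤ 2 * D := by
  refine ContinuousLinearMap.opNorm_le_bound _ (by positivity) fun f ↦ (h.strong_bound f n).trans ?_
  have h1 : D * α ^ n * ‖f‖ ≤ D * 1 * ‖f‖ := by
    gcongr; exact pow_le_one₀ hα0 hα1
  have h2 : D * w f ≤ D * ‖f‖ := by gcongr; exact hw f
  linarith

/-- As `ν` annihilates the unperturbed remainder, the functional is `ν (P - P₀)`, and weak
boundedness of `ν` turns strong-to-weak closeness into operator norm smallness. -/
theorem norm_comp_sub_rankOneOp_le {κ δ : ℝ} (hκ : 0 ≤ κ) (hδ : 0 ≤ δ) (hν : ∀ f, ‖ν f‖ ≤ κ * w f)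
    (hB₀ : ν.comp (P₀ - rankOneOp φ ν) = 0) (hclose : ∀ f, w (P f - P₀ f) ≤ δ * ‖f‖) :
    ‖ν.comp (P - rankOneOp φ ν)‖ ≤ κ * δ := by
  refine ContinuousLinearMap.opNorm_le_bound _ (by positivity) fun f ↦ ?_
  have e : ν.comp (P - rankOneOp φ ν) f = ν (P f - P₀ f) := by
    have : ν (P₀ f - ν f • φ) = 0 := DFunLike.congr_fun hB₀ f
    change ν (P f - ν f • φ) = _
    rw [← sub_zero (ν (P f - ν f • φ)), ← this, ← map_sub]
    congr 1; abel
  rw [e, mul_assoc]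
  exact (hν _).trans (mul_le_mul_of_nonneg_left (hclose f) hκ)

/-- The telescoping keeps powers of `B₀` on the right, bounded strongly, and `B` on the left,
bounded weakly, since the difference is controlled only from strong to weak. -/
theorem seminorm_pow_sub_pow_le {B B₀ : V →L[ℂ] V} {M δ : ℝ} (hM : 1 ≤ M) (hδ : 0 ≤ δ)
    (hB₀ : ‖B₀‖ ≤ M) (hBw : ∀ f, w (B f) ≤ M * w f) (hclose : ∀ f, w (B f - B₀ f) ≤ δ * ‖f‖) (f : V)
    (n : ℕ) : w ((B ^ n) f - (B₀ ^ n) f) ≤ n * M ^ n * δ * ‖f‖ := by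
  induction n with
  | zero => simp
  | succ n ih =>
    have e : (B ^ (n + 1)) f - (B₀ ^ (n + 1)) f
        = B ((B ^ n) f - (B₀ ^ n) f) + (B ((B₀ ^ n) f) - B₀ ((B₀ ^ n) f)) := by
      rw [pow_succ', pow_succ', mul_apply_eq_comp, mul_apply_eq_comp, map_sub]; abel
    have hp : ‖(B₀ ^ n) f‖ ≤ M ^ (n + 1) * ‖f‖ := by
      refine ((B₀ ^ n).le_opNorm f).trans (mul_le_mul_of_nonneg_right ?_ (norm_nonneg _))
      by_cases hV : Nontrivial V
      · exact (norm_pow_le B₀ n).trans ((pow_le_pow_left₀ (norm_nonneg _) hB₀ n).trans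
          (pow_le_pow_right₀ hM n.le_succ))
      · have : Subsingleton V := not_nontrivial_iff_subsingleton.mp hV
        rw [Subsingleton.elim (B₀ ^ n) 0, norm_zero]; positivity
    calc w ((B ^ (n + 1)) f - (B₀ ^ (n + 1)) f)
        ≤ M * (n * M ^ n * δ * ‖f‖) + δ * (M ^ (n + 1) * ‖f‖) := by
          rw [e]
          refine (map_add_le_add w _ _).trans (add_le_add ((hBw _).trans ?_) ((hclose _).trans ?_))
          · gcongr
          · gcongr
      _ = ((n + 1 : ℕ) : ℝ) * M ^ (n + 1) * δ * ‖f‖ := by push_cast; ring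

/-- The remainder `B = P - φ ⊗ ν` inherits a Lasota-Yorke type estimate. The bound for its powers
has a part that does not depend on `n`, and a part that is proportional to the distance `δ`
from the unperturbed operator. -/
theorem LasotaYorke.norm_pow_sub_rankOneOp_le (h : LasotaYorke w α D P) (hw : ∀ f, w f ≤ ‖f‖)
    (hα0 : 0 ≤ α) (hα1 : α ≤ 1) (hD : 0 ≤ D) {κ δ M : ℝ} (hκ : 0 ≤ κ) (hδ : 0 ≤ δ) (hM : 1 ≤ M)
    (hν : ∀ f, ‖ν f‖ ≤ κ * w f) (hB₀ν : ν.comp (P₀ - rankOneOp φ ν) = 0)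
    (hclose : ∀ f, w (P f - P₀ f) ≤ δ * ‖f‖) (hB : ‖P - rankOneOp φ ν‖ ≤ M)
    (hB₀ : ‖P₀ - rankOneOp φ ν‖ ≤ M) (hBw : ∀ f, w ((P - rankOneOp φ ν) f) ≤ M * w f) (m n : ℕ) :
    ‖(P - rankOneOp φ ν) ^ (m + (n + 1))‖
      ≤ D * α ^ m * (2 * D + 2 * D * ‖φ‖ * ‖ν‖ + n * (2 * D * ‖φ‖ * (κ * δ * M ^ n)))
        + D * (‖(P₀ - rankOneOp φ ν) ^ (n + 1)‖ + (n + 1 : ℕ) * M ^ (n + 1) * δ)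
        + m * (2 * D * ‖φ‖ * (κ * δ * M ^ (m + n))) := by
  have hM0 : 0 ≤ M := by linarith
  have hPn := h.norm_pow_le hw hα0 hα1 hD
  have hℓ := norm_comp_sub_rankOneOp_le hκ hδ hν hB₀ν hclose
  have hexp := norm_le_of_norm_le_of_le_rankOneOp (φ := φ) (ν := ν) hPn
  obtain ⟨B, hBdef⟩ : ∃ B, B = P - rankOneOp φ ν := ⟨_, rfl⟩
  obtain ⟨B₀, hB₀def⟩ : ∃ B, B = P₀ - rankOneOp φ ν := ⟨_, rfl⟩
  have hcl : ∀ f, w (B f - B₀ f) ≤ δ * ‖f‖ := fun f ↦ by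
    have : B f - B₀ f = P f - P₀ f := by rw [hBdef, hB₀def]; simp
    rw [this]; exact hclose f
  rw [← hBdef] at hℓ hB hexp hBw ⊢
  rw [← hB₀def] at hB₀ ⊢
  have hBpow : ∀ k f, ‖(B ^ k) f‖ ≤ M ^ k * ‖f‖ := fun k ↦ by
    induction k with
    | zero => simp
    | succ k ih =>
      intro f
      rw [pow_succ, mul_apply_eq_comp]
      calc _ ≤ M ^ k * (M * ‖f‖) := (ih _).trans (by
            gcongr; exact (B.le_opNorm f).trans (by gcongr))
        _ = _ := by ring
  have hνB : ∀ k l f, k ≤ l → ‖ν ((B ^ (k + 1)) f)‖ ≤ κ * δ * M ^ l * ‖f‖ := fun k l f hkl ↦ by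
    rw [pow_succ', mul_apply_eq_comp]
    calc _ ≤ κ * δ * (M ^ k * ‖f‖) :=
          ((ν.comp B).le_opNorm _).trans (mul_le_mul hℓ (hBpow k f) (norm_nonneg _) (by positivity))
      _ ≤ κ * δ * (M ^ l * ‖f‖) := by gcongr
      _ = _ := by ring
  refine ContinuousLinearMap.opNorm_le_bound _ (by positivity) fun f ↦ ?_
  -- The Duhamel term `k = 0` involves `ν f` and carries no `δ`; it joins the constant that is later
  -- multiplied by `α ^ m`.
  have h1 : ‖(B ^ (n + 1)) f‖
      ≤ (2 * D + 2 * D * ‖φ‖ * ‖ν‖ + n * (2 * D * ‖φ‖ * (κ * δ * M ^ n))) * ‖f‖ := by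
    have := hexp f (n + 1) 0
    rw [pow_zero, one_apply_eq_self, zero_add, Finset.sum_range_succ'] at this
    have i1 : ‖(P ^ (n + 1)) f‖ ≤ 2 * D * ‖f‖ :=
      ((P ^ (n + 1)).le_opNorm f).trans (by gcongr; exact hPn _)
    have i2 : ∑ k ∈ Finset.range n, 2 * D * ‖φ‖ * ‖ν ((B ^ (k + 1)) f)‖
        ≤ n * (2 * D * ‖φ‖ * (κ * δ * M ^ n * ‖f‖)) := by
      refine (Finset.sum_le_card_nsmul _ _ _ fun k hk ↦ ?_).trans_eq
        (by rw [Finset.card_range, nsmul_eq_mul])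
      gcongr
      exact hνB k n f (Finset.mem_range.mp hk).le
    have i3 : 2 * D * ‖φ‖ * ‖ν ((B ^ 0) f)‖ ≤ 2 * D * ‖φ‖ * (‖ν‖ * ‖f‖) := by
      gcongr; exact ν.le_opNorm f
    linarith
  have h2 : w ((B ^ (n + 1)) f) ≤ (‖B₀ ^ (n + 1)‖ + (n + 1 : ℕ) * M ^ (n + 1) * δ) * ‖f‖ := by
    have i1 := seminorm_pow_sub_pow_le hM hδ hB₀ hBw hcl f (n + 1)
    have i2 : w ((B₀ ^ (n + 1)) f) ≤ ‖B₀ ^ (n + 1)‖ * ‖f‖ :=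
      (hw _).trans ((B₀ ^ (n + 1)).le_opNorm f)
    have i3 := map_add_le_add w ((B ^ (n + 1)) f - (B₀ ^ (n + 1)) f) ((B₀ ^ (n + 1)) f)
    rw [sub_add_cancel] at i3
    linarith
  have h3 : ∑ k ∈ Finset.range m, 2 * D * ‖φ‖ * ‖ν ((B ^ k) ((B ^ (n + 1)) f))‖
      ≤ m * (2 * D * ‖φ‖ * (κ * δ * M ^ (m + n) * ‖f‖)) := by
    refine (Finset.sum_le_card_nsmul _ _ _ fun k hk ↦ ?_).trans_eq
      (by rw [Finset.card_range, nsmul_eq_mul])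
    rw [← mul_apply_eq_comp, ← pow_add, ← add_assoc]
    gcongr
    exact hνB (k + n) (m + n) f (by have := Finset.mem_range.mp hk; omega)
  -- Split `B^(m+n+1) = B^m B^(n+1)`: Duhamel replaces `B^m` by `P^m`, whose Lasota-Yorke bound
  -- needs the strong norm `h1` and the weak seminorm `h2` of `B^(n+1) f`. The power `n + 1 ≥ 1`
  -- puts a factor `ν B`, hence `δ`, in every correction.
  have h4 := hexp ((B ^ (n + 1)) f) m 0
  rw [pow_zero, one_apply_eq_self, zero_add] at h4
  have h5 := h.strong_bound ((B ^ (n + 1)) f) m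
  have h6 := mul_le_mul_of_nonneg_left h1 (by positivity : 0 ≤ D * α ^ m)
  have h7 := mul_le_mul_of_nonneg_left h2 hD
  rw [pow_add, mul_apply_eq_comp]
  linarith

/-- Uniform eventual contraction of `P - φ ⊗ ν` for all `P` which satisfy the same Lasota-Yorke
inequalities as `P₀` and which are close to `P₀` from the strong norm to the weak seminorm. -/
theorem exists_forall_norm_pow_sub_rankOneOp_le_half (hw : ∀ f, w f ≤ ‖f‖) (hα0 : 0 ≤ α)
    (hα1 : α < 1) (hD : 0 ≤ D) {κ : ℝ} (hκ : 0 ≤ κ) (hν : ∀ f, ‖ν f‖ ≤ κ * w f)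
    (h₀ : LasotaYorke w α D P₀) (hB₀ν : ν.comp (P₀ - rankOneOp φ ν) = 0)
    (hB₀ : Tendsto (fun n ↦ ‖(P₀ - rankOneOp φ ν) ^ n‖) atTop (𝓝 0)) :
    ∃ M ≥ (1 : ℝ), ∃ N > 0, ∃ δ > 0, ∀ P : V →L[ℂ] V, LasotaYorke w α D P →
      (∀ f, w (P f - P₀ f) ≤ δ * ‖f‖) →
        ‖P - rankOneOp φ ν‖ ≤ M ∧ ‖(P - rankOneOp φ ν) ^ N‖ ≤ 1 / 2 := by
  obtain ⟨M, hMdef⟩ : ∃ M, M = 1 + 2 * D + ‖φ‖ * ‖ν‖ + κ * ‖φ‖ := ⟨_, rfl⟩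
  have hM : 1 ≤ M := by
    have : 0 ≤ 2 * D + ‖φ‖ * ‖ν‖ + κ * ‖φ‖ := by positivity
    linarith
  have hMB : ∀ P : V →L[ℂ] V, LasotaYorke w α D P → ‖P - rankOneOp φ ν‖ ≤ M := fun P hP ↦ by
    have h1 := hP.norm_pow_le hw hα0 hα1.le hD 1
    rw [pow_one] at h1
    have h2 := norm_sub_le P (rankOneOp φ ν)
    rw [norm_rankOneOp] at h2
    have : 0 ≤ κ * ‖φ‖ := by positivity
    linarith
  have hMw : ∀ P : V →L[ℂ] V, LasotaYorke w α D P → ∀ f, w ((P - rankOneOp φ ν) f) ≤ M * w f :=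
    fun P hP f ↦ by
    have h1 := hP.weak_bound f 1
    rw [pow_one] at h1
    have h2 : w (P f - ν f • φ) ≤ w (P f) + w (ν f • φ) := map_sub_le_add w _ _
    rw [map_smul_eq_mul] at h2
    have h3 : ‖ν f‖ * w φ ≤ (κ * w f) * ‖φ‖ :=
      mul_le_mul (hν f) (hw φ) (apply_nonneg w φ) (mul_nonneg hκ (apply_nonneg w f))
    have h4 : 0 ≤ (1 + D + ‖φ‖ * ‖ν‖) * w f := mul_nonneg (by positivity) (apply_nonneg w f)
    change w (P f - ν f • φ) ≤ _
    rw [hMdef]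
    linarith
  -- `m` and `n` are fixed before `δ`, which absorbs all terms growing with them: `1 / 8 + 1 / 8 + 1
  -- / 4 = 1 / 2`.
  obtain ⟨m, hm⟩ : ∃ m : ℕ, D * α ^ m * (2 * D + 2 * D * ‖φ‖ * ‖ν‖) < 1 / 8 := by
    have := ((tendsto_pow_atTop_nhds_zero_of_lt_one hα0 hα1).const_mul D).mul_const
      (2 * D + 2 * D * ‖φ‖ * ‖ν‖)
    rw [mul_zero, zero_mul] at this
    exact (this.eventually_lt_const (by norm_num)).exists
  obtain ⟨n, hn⟩ : ∃ n : ℕ, D * ‖(P₀ - rankOneOp φ ν) ^ (n + 1)‖ < 1 / 8 := by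
    have := ((tendsto_add_atTop_iff_nat 1).mpr hB₀).const_mul D
    rw [mul_zero] at this
    exact (this.eventually_lt_const (by norm_num)).exists
  obtain ⟨b, hb⟩ : ∃ b, b = D * α ^ m * (n * (2 * D * ‖φ‖ * (κ * M ^ n)))
    + D * ((n + 1 : ℕ) * M ^ (n + 1)) + m * (2 * D * ‖φ‖ * (κ * M ^ (m + n))) := ⟨_, rfl⟩
  have hb0 : 0 ≤ b := by rw [hb]; positivity
  obtain ⟨δ, hδ⟩ : ∃ δ, δ = 1 / (4 * (b + 1)) := ⟨_, rfl⟩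
  have hδ0 : 0 < δ := by rw [hδ]; positivity
  have hbδ : b * δ ≤ 1 / 4 := by
    rw [hδ, mul_one_div, div_le_div_iff₀ (by positivity) (by norm_num)]; linarith
  refine ⟨M, hM, m + (n + 1), by omega, δ, hδ0, fun P hP hclose ↦ ⟨hMB P hP, ?_⟩⟩
  refine (hP.norm_pow_sub_rankOneOp_le hw hα0 hα1.le hD hκ hδ0.le hM hν hB₀ν hclose (hMB P hP)
    (hMB P₀ h₀) (hMw P hP) m n).trans ?_
  rw [hb] at hbδ
  linarith

end LasotaYorke

/-! ### Consequences of mixing -/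

section Mixing

theorem summable_norm_pow_of_spectralRadius_lt_one {R : Type*} [NormedRing R] [NormedAlgebra ℂ R]
    [CompleteSpace R] {a : R} (ha : spectralRadius ℂ a < 1) : Summable fun n ↦ ‖a ^ n‖ := by
  obtain ⟨q, hq, hq1⟩ := ENNReal.lt_iff_exists_nnreal_btwn.mp ha
  have hq1' : (q : ℝ) < 1 := by exact_mod_cast hq1
  refine Summable.of_norm_bounded_eventually_nat
    (summable_geometric_of_lt_one q.coe_nonneg hq1') ?_
  filter_upwards [(spectrum.pow_nnnorm_pow_one_div_tendsto_nhds_spectralRadius a).eventually_lt_const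
    hq, eventually_gt_atTop 0] with n hn hn0
  have hn0' : (0 : ℝ) < n := by exact_mod_cast hn0
  rw [one_div, ENNReal.rpow_inv_lt_iff hn0', ENNReal.rpow_natCast] at hn
  rw [norm_norm]
  exact_mod_cast hn.le

variable {V : Type*} [NormedAddCommGroup V] [NormedSpace ℂ V]
variable {P Q : V →L[ℂ] V} {φ : V} {ν : V →L[ℂ] ℂ}

/-- `P φ = φ` and `Q φ = 0` give `ν(φ) φ = φ`; and `φ = 0` would force `P = Q`, so `ν = ν P = ν Q =
0`. -/
theorem OperatorMixing.eigenfunctional_apply_eq_one (h : OperatorMixing P φ ν Q) (hν : ν ≠ 0) :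
    ν φ = 1 := by
  have hφ : φ ≠ 0 := by
    rintro rfl
    apply hν
    have h1 := h.relations.comp_eigenfunctional
    have h2 : P = Q := by rw [h.decomposition]; ext f; simp
    rw [h2, h.relations.comp_remainder, one_smul] at h1
    exact h1.symm
  have h1 := h.relations.apply_eigenvector
  rw [h.decomposition, add_apply, h.relations.remainder_apply, rankOneOp_apply, add_zero] at h1
  exact smul_left_injective ℂ hφ h1

theorem OperatorMixing.smul_eq_pow_sub_pow (h : OperatorMixing P φ ν Q) (f : V) (n : ℕ) :
    ν f • φ = (P ^ n) f - (Q ^ n) (f - ν f • φ) := by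
  have hνP : ∀ g, ν (P g) = ν g := fun g ↦ by
    simpa using DFunLike.congr_fun h.relations.comp_eigenfunctional g
  induction n generalizing f with
  | zero => simp
  | succ n ih =>
    have := ih (P f)
    rw [hνP] at this
    rw [pow_succ, pow_succ, mul_apply_eq_comp, mul_apply_eq_comp, map_sub Q, map_smul Q,
      h.relations.remainder_apply, smul_zero, sub_zero, this]
    congr 2
    rw [h.decomposition, add_apply, rankOneOp_apply]
    abel

/-- `P ^ n f` converges to `ν(f) φ`, so the weak bound passes to the limit: `‖ν f‖ * w φ ≤ D * w f`.
Here `w φ > 0`, because the strong bound at the fixed vector `φ` gives `‖φ‖ ≤ D * w φ` in the limit.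
-/
theorem OperatorMixing.exists_eigenfunctional_le_seminorm [CompleteSpace V]
    (h : OperatorMixing P φ ν Q) (hν : ν φ = 1) {w : Seminorm ℂ V} {α D : ℝ}
    (hP : LasotaYorke w α D P) (hw : ∀ f, w f ≤ ‖f‖) (hα0 : 0 ≤ α) (hα1 : α < 1) :
    ∃ κ : ℝ, 0 ≤ κ ∧ ∀ f, ‖ν f‖ ≤ κ * w f := by
  have hφ : φ ≠ 0 := by rintro rfl; simp at hν
  have hPφ : ∀ n, (P ^ n) φ = φ := fun n ↦ by
    induction n with
    | zero => simp
    | succ n ih =>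
      rw [pow_succ, mul_apply_eq_comp, h.relations.apply_eigenvector, one_smul, ih]
  have h1 : ‖φ‖ ≤ D * w φ := by
    have ht : Tendsto (fun n ↦ D * α ^ n * ‖φ‖ + D * w φ) atTop (𝓝 (D * 0 * ‖φ‖ + D * w φ)) :=
      (((tendsto_pow_atTop_nhds_zero_of_lt_one hα0 hα1).const_mul D).mul_const _).add_const _
    rw [mul_zero, zero_mul, zero_add] at ht
    refine ge_of_tendsto' ht fun n ↦ ?_
    have := hP.strong_bound φ n
    rwa [hPφ] at this
  have hwφ : 0 < w φ := by
    refine (apply_nonneg w φ).lt_of_ne fun h0 ↦ ?_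
    rw [← h0, mul_zero] at h1
    exact hφ (norm_le_zero_iff.mp h1)
  have hD : 0 ≤ D := by
    have := (norm_nonneg φ).trans h1
    exact nonneg_of_mul_nonneg_left this hwφ
  have hQ := (summable_norm_pow_of_spectralRadius_lt_one h.spectralRadius_lt).tendsto_atTop_zero
  refine ⟨D / w φ, by positivity, fun f ↦ ?_⟩
  have h2 : ‖ν f‖ * w φ ≤ D * w f := by
    have ht : Tendsto (fun n ↦ D * w f + ‖Q ^ n‖ * ‖f - ν f • φ‖) atTop
        (𝓝 (D * w f + 0 * ‖f - ν f • φ‖)) := (hQ.mul_const _).const_add _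
    rw [zero_mul, add_zero] at ht
    refine ge_of_tendsto' ht fun n ↦ ?_
    have e := congrArg w (h.smul_eq_pow_sub_pow f n)
    rw [map_smul_eq_mul] at e
    rw [e]
    exact (map_sub_le_add w _ _).trans (add_le_add (hP.weak_bound f n)
      ((hw _).trans ((Q ^ n).le_opNorm (f - ν f • φ))))
  rw [div_mul_eq_mul_div, le_div_iff₀ hwφ]
  exact h2

end Mixing

theorem GenFunSpace.IsIntegration.ne_zero {M : Type*} [MeasurableSpace M] {V : Type*}
    [AddCommGroup V] [Module ℂ V] {G : GenFunSpace M V} {m₀ : Measure M} [IsFiniteMeasure m₀]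
    (hm₀ : m₀ ≠ 0) {ν : V → ℂ} (h : G.IsIntegration m₀ ν) : ν ≠ 0 := by
  rintro rfl
  obtain ⟨h₀, hν⟩ := h
  obtain ⟨u, hu⟩ := G.one_mem
  have := (hν u).trans (hu _)
  rw [withDensityᵥ_apply (integrable_const _) MeasurableSet.univ] at this
  have h1 : (m₀ Set.univ).toReal ≠ 0 :=
    ENNReal.toReal_ne_zero.mpr ⟨Measure.measure_univ_ne_zero.mpr hm₀, measure_ne_top m₀ _⟩
  exact h1 (by simpa [measureReal_def] using this.symm)

/-! ### Rare events and assembly -/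

section REPFO

variable {V : Type*} [NormedAddCommGroup V] [NormedSpace ℂ V]
variable {E : Type*} [TopologicalSpace E] [Zero E]

theorem UniformSpectralBounds.lasotaYorke {P : E → V →L[ℂ] V} {w : Seminorm ℂ V} {α D : ℝ}
    {π : E → ℝ} (h : UniformSpectralBounds P w α D π) (ε : E) : LasotaYorke w α D (P ε) :=
  ⟨h.weak_bound ε, h.strong_bound ε⟩

theorem UniformSpectralBounds.eventually_close {P : E → V →L[ℂ] V} {w : Seminorm ℂ V} {α D : ℝ}
    {π : E → ℝ} (h : UniformSpectralBounds P w α D π) {δ : ℝ} (hδ : 0 < δ) :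
    ∀ᶠ ε in 𝓝 (0 : E), ∀ f, w (P ε f - P 0 f) ≤ δ * ‖f‖ := by
  have h1 := eventually_nhdsWithin_iff.mp (h.pi_tendsto.eventually_le_const hδ)
  filter_upwards [h1] with ε hε f
  by_cases h0 : ε = 0
  · rw [h0, sub_self, map_zero]; positivity
  · exact (h.close ε f).trans (mul_le_mul_of_nonneg_right (hε h0) (norm_nonneg _))

variable {M : Type*} [MeasurableSpace M] {G : GenFunSpace M V} {T : M → M} {m₀ : Measure M}
  {A : E → Set M} {P : E → V →L[ℂ] V} {φ₀ : V} {ν₀ : V →L[ℂ] ℂ} {Q₀ : V →L[ℂ] V}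

theorem IsREPFO.sub_apply (h : IsREPFO G T m₀ A P φ₀ ν₀ Q₀) (ε : E) (f : V) :
    (P 0 - P ε) f = P 0 (G.indicatorMul (A ε) f) := by
  obtain ⟨g, hg⟩ := h.indicator_mem ε f
  rw [_root_.sub_apply, h.hole ε, (hg.compl (h.measurableSet_hole ε)).eq, hg.eq, ← map_sub,
    sub_sub_cancel]

theorem IsREPFO.assumptionA6 (h : IsREPFO G T m₀ A P φ₀ ν₀ Q₀) :
    ∃ C : ℝ, ∀ ε, ‖ν₀.comp (P 0 - P ε)‖ * ‖(P 0 - P ε) φ₀‖ ≤ C * ‖ν₀ ((P 0 - P ε) φ₀)‖ := by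
  obtain ⟨C, hC⟩ := h.rare
  have hνP : ∀ g, ν₀ (P 0 g) = ν₀ g := fun g ↦ by
    simpa using DFunLike.congr_fun h.mixing.relations.comp_eigenfunctional g
  refine ⟨‖P 0‖ * |C|, fun ε ↦ ?_⟩
  have h1 : ‖ν₀.comp (P 0 - P ε)‖ * ‖G.indicatorMul (A ε) φ₀‖
      ≤ |C| * ‖ν₀ ((P 0 - P ε) φ₀)‖ := by
    -- Moving the number `‖1_A φ₀‖` into the functional lets (iii) bound an operator norm without
    -- dividing by a possibly zero quantity.
    rw [← norm_norm (G.indicatorMul (A ε) φ₀), mul_comm, ← norm_smul]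
    refine ContinuousLinearMap.opNorm_le_bound _ (by positivity) fun f ↦ ?_
    rw [_root_.smul_apply, norm_smul, norm_norm, ContinuousLinearMap.comp_apply, h.sub_apply,
      h.sub_apply, hνP, hνP, mul_comm]
    refine (hC ε f).trans ?_
    rw [mul_right_comm]
    gcongr
    exact le_abs_self C
  have h2 : ‖(P 0 - P ε) φ₀‖ ≤ ‖P 0‖ * ‖G.indicatorMul (A ε) φ₀‖ := by
    rw [h.sub_apply]; exact (P 0).le_opNorm _
  calc _ ≤ ‖ν₀.comp (P 0 - P ε)‖ * (‖P 0‖ * ‖G.indicatorMul (A ε) φ₀‖) := by gcongr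
    _ = ‖P 0‖ * (‖ν₀.comp (P 0 - P ε)‖ * ‖G.indicatorMul (A ε) φ₀‖) := by ring
    _ ≤ ‖P 0‖ * (|C| * ‖ν₀ ((P 0 - P ε) φ₀)‖) := by gcongr
    _ = _ := by ring

end REPFO

theorem assumptionA3_of_summable {V : Type*} [NormedAddCommGroup V] [NormedSpace ℂ V] {E : Type*}
    {S : Set E} {Q : E → V →L[ℂ] V} {c : ℕ → ℝ} (hc : Summable c)
    (hQ : ∀ ε ∈ S, ∀ n, ‖Q ε ^ n‖ ≤ c n) : AssumptionA3 S Q := by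
  refine lt_of_le_of_lt (ENNReal.tsum_le_tsum fun n ↦ ?_) hc.tsum_ofReal_lt_top
  refine iSup₂_le fun ε hε ↦ ?_
  rw [← ofReal_norm]
  exact ENNReal.ofReal_le_ofReal (hQ ε hε n)

theorem mainTheorem1
    {E : Type*} [TopologicalSpace E] [Zero E]
    {M : Type*} [MetricSpace M] [MeasurableSpace M] [OpensMeasurableSpace M]
    {V : Type*} [NormedAddCommGroup V] [NormedSpace ℂ V] [CompleteSpace V]
    (G : GenFunSpace M V) (T : M → M)
    (m₀ : Measure M) [IsFiniteMeasure m₀] (hm₀ : m₀ ≠ 0)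
    (A : E → Set M) (P : E → V →L[ℂ] V)
    (φ₀ : V) (ν₀ : V →L[ℂ] ℂ) (Q₀ : V →L[ℂ] V)
    (h : IsREPFO G T m₀ A P φ₀ ν₀ Q₀) :
    ∃ N ∈ 𝓝 (0 : E), ∃ (lam : E → ℂ) (φ : E → V) (ν : E → V →L[ℂ] ℂ) (Q : E → V →L[ℂ] V),
      (φ 0 = φ₀ ∧ ν 0 = ν₀ ∧ Q 0 = Q₀) ∧
      AssumptionA1 N P lam φ ν Q ∧
      AssumptionA2 N P lam φ ν Q ∧
      AssumptionA3 N Q ∧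
      AssumptionA4 N φ ν ∧
      AssumptionA5 P ν ∧
      AssumptionA6 Set.univ P φ ν := by
  classical
  obtain ⟨w, α, D, π, hs⟩ := h.spectral
  have hα0 := hs.alpha_pos.le
  have hν₀ : ν₀ φ₀ = 1 := h.mixing.eigenfunctional_apply_eq_one fun h0 ↦
    h.integration.ne_zero hm₀ (by rw [h0]; rfl)
  obtain ⟨κ, hκ0, hκ⟩ := h.mixing.exists_eigenfunctional_le_seminorm hν₀ (hs.lasotaYorke 0)
    hs.weak_le_norm hα0 hs.alpha_lt_one
  have hQ₀ : P 0 - rankOneOp φ₀ ν₀ = Q₀ := by rw [h.mixing.decomposition, add_sub_cancel_left]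
  have hB₀ν : ν₀.comp (P 0 - rankOneOp φ₀ ν₀) = 0 := by
    rw [hQ₀]; exact h.mixing.relations.comp_remainder
  have hQ₀s := summable_norm_pow_of_spectralRadius_lt_one h.mixing.spectralRadius_lt
  obtain ⟨K, hK, n, hn, δ, hδ, hB⟩ := exists_forall_norm_pow_sub_rankOneOp_le_half
    hs.weak_le_norm hα0 hs.alpha_lt_one hs.D_pos.le hκ0 hκ (hs.lasotaYorke 0) hB₀ν
    (by rw [hQ₀]; exact hQ₀s.tendsto_atTop_zero)
  obtain ⟨η, hη, r, c, hr, hc0, hc, hpert⟩ := exists_eigenRelations_of_small hν₀ hK hn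
  have hA5 : ∀ {ρ : ℝ}, 0 < ρ → ∀ᶠ ε in 𝓝 (0 : E), ‖ν₀.comp (P ε - rankOneOp φ₀ ν₀)‖ ≤ ρ := by
    intro ρ hρ
    filter_upwards [hs.eventually_close (δ := ρ / (κ + 1)) (by positivity)] with ε hε
    refine (norm_comp_sub_rankOneOp_le hκ0 (by positivity) hκ hB₀ν hε).trans ?_
    rw [mul_div_assoc', div_le_iff₀ (by positivity)]
    linarith
  have hex : ∀ᶠ ε in 𝓝 (0 : E), ∃ (lam : ℂ) (φ : V) (ν : V →L[ℂ] ℂ) (Q : V →L[ℂ] V), lam ≠ 0 ∧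
      lam⁻¹ • P ε = rankOneOp φ ν + Q ∧ EigenRelations (P ε) lam φ ν Q ∧
      ν₀ φ = 1 ∧ ‖φ‖ ≤ r ∧ ∀ n, ‖Q ^ n‖ ≤ c n := by
    filter_upwards [hs.eventually_close hδ, hA5 hη] with ε h1 h2
    obtain ⟨h3, h4⟩ := hB (P ε) (hs.lasotaYorke ε) h1
    have := hpert _ h3 h4 h2
    rwa [sub_add_cancel] at this
  -- The data at `0` must be the prescribed ones, not those of the fixed point argument, so the
  -- bounds are enlarged by `‖φ₀‖` and `‖Q₀ ^ n‖`. Where no perturbed data exist, the unperturbed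
  -- ones are default values.
  have hex' : ∀ ε : E, ∃ (lam : ℂ) (φ : V) (ν : V →L[ℂ] ℂ) (Q : V →L[ℂ] V),
      (ε = 0 → lam = 1 ∧ φ = φ₀ ∧ ν = ν₀ ∧ Q = Q₀) ∧
      ((∃ (lam : ℂ) (φ : V) (ν : V →L[ℂ] ℂ) (Q : V →L[ℂ] V), lam ≠ 0 ∧
        lam⁻¹ • P ε = rankOneOp φ ν + Q ∧ EigenRelations (P ε) lam φ ν Q ∧
        ν₀ φ = 1 ∧ ‖φ‖ ≤ r ∧ ∀ n, ‖Q ^ n‖ ≤ c n) → lam ≠ 0 ∧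
        lam⁻¹ • P ε = rankOneOp φ ν + Q ∧ EigenRelations (P ε) lam φ ν Q ∧
        ν₀ φ = 1 ∧ ‖φ‖ ≤ r + ‖φ₀‖ ∧ ∀ n, ‖Q ^ n‖ ≤ c n + ‖Q₀ ^ n‖) := by
    intro ε
    by_cases h0 : ε = 0
    · subst h0
      exact ⟨1, φ₀, ν₀, Q₀, fun _ ↦ ⟨rfl, rfl, rfl, rfl⟩, fun _ ↦ ⟨one_ne_zero,
        by rw [inv_one, one_smul]; exact h.mixing.decomposition, h.mixing.relations, hν₀,
        by linarith, fun n ↦ by linarith [hc0 n]⟩⟩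
    · by_cases he : ∃ (lam : ℂ) (φ : V) (ν : V →L[ℂ] ℂ) (Q : V →L[ℂ] V), lam ≠ 0 ∧
        lam⁻¹ • P ε = rankOneOp φ ν + Q ∧ EigenRelations (P ε) lam φ ν Q ∧
        ν₀ φ = 1 ∧ ‖φ‖ ≤ r ∧ ∀ n, ‖Q ^ n‖ ≤ c n
      · obtain ⟨lam, φ, ν, Q, h1, h2, h3, h4, h5, h6⟩ := he
        exact ⟨lam, φ, ν, Q, fun h ↦ absurd h h0, fun _ ↦ ⟨h1, h2, h3, h4,
          by linarith [norm_nonneg φ₀], fun n ↦ by linarith [h6 n, norm_nonneg (Q₀ ^ n)]⟩⟩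
      · exact ⟨1, φ₀, ν₀, Q₀, fun h ↦ absurd h h0, fun h ↦ absurd h he⟩
  choose lam φ ν Q hz hall using hex'
  obtain ⟨hlam0, hφ0, hνz, hQz⟩ := hz 0 rfl
  refine ⟨_, hex, lam, φ, ν, Q, ⟨hφ0, hνz, hQz⟩,
    ⟨hlam0, fun ε hε ↦ ⟨(hall ε hε).1, (hall ε hε).2.1⟩⟩, fun ε hε ↦ (hall ε hε).2.2.1,
    assumptionA3_of_summable (hc.add hQ₀s) fun ε hε ↦ (hall ε hε).2.2.2.2.2,
    ⟨r + ‖φ₀‖, by positivity, fun ε hε ↦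
      ⟨by rw [hνz]; exact (hall ε hε).2.2.2.1, (hall ε hε).2.2.2.2.1⟩⟩, ?_, ?_⟩
  · rw [AssumptionA5, hνz, Metric.tendsto_nhds]
    intro ρ hρ
    filter_upwards [hA5 (half_pos hρ)] with ε hε
    have e : ν₀.comp (P 0 - P ε) = -ν₀.comp (P ε - rankOneOp φ₀ ν₀) := by
      rw [← add_zero (-_), ← hB₀ν]
      ext f
      simp
    rw [dist_zero_right, norm_norm, e, norm_neg]
    linarith
  · obtain ⟨C, hC⟩ := h.assumptionA6
    refine ⟨C, fun ε _ ↦ ?_⟩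
    rw [perturbationSize, hνz, hφ0]
    exact hC ε
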